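/- Let $(\mathbb{X}, |\cdot|)$ be a (real or complex) Banach space, and let $f : \mathbb{R} \to \mathbb{X}$ be Bohr-almost periodic, that is, $f$ is continuous and, for every $\varepsilon > 0$, the set $$\mathcal{P}_\varepsilon = \Bigl\{ t \in \mathbb{R} : \sup_{x \in \mathbb{R}} |f(x) - f(x-t)| < \varepsilon \Bigr\}$$ is relatively dense in $\mathbb{R}$ (for some $L > 0$, it meets every interval $[a, a+L]$ with $a \in \mathbb{R}$). Then the mean $$M(f) = \lim_{T \to \infty} \frac{1}{2T} \int_{a-T}^{a+T} f(x) \, dx \in \mathbb{X},$$ with the integral taken in the sense of Bochner, exists for every $a \in \mathbb{R}$, is independent of $a$, and the convergence is uniform in $a$. Moreover, for every fixed $\alpha \in \mathbb{R}$ with $|\alpha| > 1$, one has $$\lim_{N \to \infty} \frac{1}{N} \sum_{n=0}^{N-1} f(\alpha^n x) = M(f)$$ in the norm of $\mathbb{X}$, for Lebesgue-almost every $x \in \mathbb{R}$. -/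

import Mathlib

open Filter Topology MeasureTheory
open scoped ENNReal

/-- The supremum norm `‖f‖_∞ = sup_x |f x|`, with values in `[0, ∞]`
(so it is `∞` for an unbounded function). -/
noncomputable def supNorm {X : Type*} [NormedAddCommGroup X] (f : ℝ → X) : ℝ≥0∞ :=
  ⨆ x : ℝ, ‖f x‖ₑ

/-- The set of `ε`-almost periods of `f`: all `t` with `‖f - T_t f‖_∞ < ε`,
where `(T_t f) x = f (x - t)` is the translate of `f`. -/
def almostPeriods {X : Type*} [NormedAddCommGroup X] (f : ℝ → X) (ε : ℝ) : Set ℝ :=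
  {t : ℝ | supNorm (f - translate t f) < ENNReal.ofReal ε}

/-- A subset of the real line is relatively dense if, for some `L > 0`, it meets every
interval `[a, a + L]`. -/
def IsRelativelyDense (S : Set ℝ) : Prop :=
  ∃ L : ℝ, 0 < L ∧ ∀ a : ℝ, (S ∩ Set.Icc a (a + L)).Nonempty

/-- A function on the real line is Bohr-almost periodic if it is continuous and, for every
`ε > 0`, its set of `ε`-almost periods is relatively dense. -/
def IsBohrAlmostPeriodic {X : Type*} [NormedAddCommGroup X] (f : ℝ → X) : Prop :=
  Continuous f ∧ ∀ ε : ℝ, 0 < ε → IsRelativelyDense (almostPeriods f ε)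

/-- `m` is the mean of `f`: the averages `(1 / 2T) ∫_{a-T}^{a+T} f(x) dx` (Bochner integrals of
a locally integrable function) converge to `m` as `T → ∞`, for all `a` and uniformly in `a`. -/
def HasMean {X : Type*} [NormedAddCommGroup X] [NormedSpace ℝ X] (f : ℝ → X) (m : X) : Prop :=
  LocallyIntegrable f volume ∧
    TendstoUniformly (fun (T a : ℝ) => (1 / (2 * T)) • ∫ x in (a - T)..(a + T), f x)
      (fun _ : ℝ => m) atTop

/-! The averages of an almost periodic `f` over intervals of radius `S` and `T` commute, and an
average over a long interval barely depends on its centre. Hence the two-fold average is close to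
either of them, and the mean exists.

The range of `f` is totally bounded, so the ergodic sums stay in a compact convex set, on which
convergence may be tested against countably many functionals. This reduces the pointwise statement
to real-valued uniformly continuous `f` with a mean `m`. There `f - m` is uniformly approximated by
`g - A_T g`, where `g` is an average of `f` over short intervals and `A_T` averages over long ones.
The function `g - A_T g` has bounded derivative and bounded primitive, so integration by parts
makes the correlation over a bounded interval of its dilates by `α ^ m` and `α ^ n` at most a
constant times `|α| ^ (-|m - n|)`. The second moment of the `N`-th partial sum is then `O(N)`, the
averages along `N = k ^ 2` are square summable, and the gaps are filled by monotonicity. -/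

section AlmostPeriodic

variable {X : Type*} [NormedAddCommGroup X] {f : ℝ → X}

lemma norm_sub_lt_of_mem_almostPeriods {ε t : ℝ} (ht : t ∈ almostPeriods f ε) (x : ℝ) :
    ‖f x - f (x - t)‖ < ε := by
  have h : ‖f x - f (x - t)‖ₑ < ENNReal.ofReal ε :=
    (le_iSup (fun x => ‖(f - translate t f) x‖ₑ) x).trans_lt ht
  rw [← ofReal_norm] at h
  exact (ENNReal.ofReal_lt_ofReal_iff_of_nonneg (norm_nonneg _)).1 h

namespace IsBohrAlmostPeriodic

lemma exists_forall_sub_mem_Icc (hf : IsBohrAlmostPeriodic f) {ε : ℝ} (hε : 0 < ε) :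
    ∃ L : ℝ, ∀ x b : ℝ, ∃ t, x - t ∈ Set.Icc b (b + L) ∧ ∀ y, ‖f y - f (y - t)‖ < ε := by
  obtain ⟨L, -, hL⟩ := hf.2 ε hε
  refine ⟨L, fun x b => ?_⟩
  obtain ⟨t, ht, hbt, htb⟩ := hL (x - b - L)
  exact ⟨t, ⟨by linarith, by linarith⟩, norm_sub_lt_of_mem_almostPeriods ht⟩

lemma totallyBounded_range (hf : IsBohrAlmostPeriodic f) : TotallyBounded (Set.range f) := by
  refine Metric.totallyBounded_iff.2 fun ε hε => ?_
  obtain ⟨L, hL⟩ := hf.exists_forall_sub_mem_Icc (half_pos hε)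
  obtain ⟨c, hc, hcover⟩ := Metric.totallyBounded_iff.1
    ((isCompact_Icc (a := 0) (b := 0 + L)).image hf.1).totallyBounded (ε / 2) (half_pos hε)
  refine ⟨c, hc, Set.range_subset_iff.2 fun x => ?_⟩
  obtain ⟨t, hxt, ht⟩ := hL x 0
  obtain ⟨y, hy, hxy⟩ := Set.mem_iUnion₂.1 (hcover ⟨x - t, hxt, rfl⟩)
  refine Set.mem_iUnion₂.2 ⟨y, hy, ?_⟩
  calc dist (f x) y ≤ dist (f x) (f (x - t)) + dist (f (x - t)) y := dist_triangle _ _ _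
    _ < ε / 2 + ε / 2 := add_lt_add ((dist_eq_norm _ _).trans_lt (ht x)) hxy
    _ = ε := add_halves ε

lemma uniformContinuous (hf : IsBohrAlmostPeriodic f) : UniformContinuous f := by
  refine Metric.uniformContinuous_iff.2 fun ε hε => ?_
  have hε₃ : 0 < ε / 3 := by positivity
  obtain ⟨L, hL⟩ := hf.exists_forall_sub_mem_Icc hε₃
  obtain ⟨δ, hδ, hfδ⟩ := Metric.uniformContinuousOn_iff.1
    ((isCompact_Icc (a := -1) (b := L + 1)).uniformContinuousOn_of_continuous hf.1.continuousOn)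
    (ε / 3) hε₃
  refine ⟨min δ 1, lt_min hδ one_pos, fun {x y} hxy => ?_⟩
  obtain ⟨t, ⟨h0x, hxL⟩, ht⟩ := hL x 0
  obtain ⟨hxy₁, hxy₂⟩ := abs_lt.1 (hxy.trans_le (min_le_right _ _))
  have hclose : dist (f (x - t)) (f (y - t)) < ε / 3 := by
    refine hfδ _ ⟨by linarith, by linarith⟩ _ ⟨by linarith, by linarith⟩ ?_
    rw [dist_sub_right]
    exact hxy.trans_le (min_le_left _ _)
  have hx := ht x
  have hy := ht y
  rw [← dist_eq_norm] at hx hy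
  linarith [dist_triangle4_right (f x) (f y) (f (x - t)) (f (y - t))]

end IsBohrAlmostPeriodic

end AlmostPeriodic

section Steklov

variable {X : Type*} [NormedAddCommGroup X] [NormedSpace ℝ X]

/-- The Steklov average of `f`: its mean value over the interval of radius `T` centred at `x`.
The formula is the one in `HasMean`. -/
noncomputable def steklovAverage (T : ℝ) (f : ℝ → X) (x : ℝ) : X :=
  (1 / (2 * T)) • ∫ t in (x - T)..(x + T), f t

/-- The symmetric difference quotient of `f` with step `T`. It is the Steklov average of the
derivative of `f`. -/
noncomputable def symmDiffQuotient (T : ℝ) (f : ℝ → X) (x : ℝ) : X :=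
  (1 / (2 * T)) • (f (x + T) - f (x - T))

variable {f g F : ℝ → X} {c : X} {M S T r x : ℝ}

lemma hasDerivAt_symmDiffQuotient (hF : ∀ x, HasDerivAt F (f x) x) (x : ℝ) :
    HasDerivAt (symmDiffQuotient T F) (symmDiffQuotient T f x) x :=
  (((hF _).comp_add_const x T).sub ((hF _).comp_sub_const x T)).const_smul _

lemma symmDiffQuotient_comm (S T : ℝ) (f : ℝ → X) :
    symmDiffQuotient S (symmDiffQuotient T f) = symmDiffQuotient T (symmDiffQuotient S f) := by
  ext x
  simp only [symmDiffQuotient, add_right_comm x S T, sub_right_comm x S T,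
    ← add_sub_right_comm x T S, ← add_sub_right_comm x S T]
  module

lemma norm_symmDiffQuotient_le (hT : 0 < T) (hM : ∀ x, ‖f x‖ ≤ M) (x : ℝ) :
    ‖symmDiffQuotient T f x‖ ≤ M / T := by
  rw [symmDiffQuotient, norm_smul, Real.norm_of_nonneg (by positivity)]
  calc 1 / (2 * T) * ‖f (x + T) - f (x - T)‖ ≤ 1 / (2 * T) * (M + M) := by
        gcongr
        exact norm_sub_le_of_le (hM _) (hM _)
    _ = M / T := by field_simp; ring

lemma steklovAverage_sub (hf : Continuous f) (hg : Continuous g) (T x : ℝ) :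
    steklovAverage T (fun y => f y - g y) x = steklovAverage T f x - steklovAverage T g x := by
  simp only [steklovAverage, intervalIntegral.integral_sub (hf.intervalIntegrable _ _)
    (hg.intervalIntegrable _ _), smul_sub]

lemma steklovAverage_comp_sub_right (f : ℝ → X) (T x t : ℝ) :
    steklovAverage T (fun y => f (y - t)) x = steklovAverage T f (x - t) := by
  simp only [steklovAverage, intervalIntegral.integral_comp_sub_right, sub_right_comm x T t,
    add_sub_right_comm x T t]

variable [CompleteSpace X]

lemma steklovAverage_const (hT : T ≠ 0) (c : X) (x : ℝ) : steklovAverage T (fun _ => c) x = c := by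
  rw [steklovAverage, intervalIntegral.integral_const, smul_smul,
    show 1 / (2 * T) * (x + T - (x - T)) = 1 by field_simp; ring, one_smul]

lemma norm_steklovAverage_sub_le (hf : Continuous f) (hT : 0 < T)
    (h : ∀ t ∈ Set.Icc (x - T) (x + T), ‖f t - c‖ ≤ r) : ‖steklovAverage T f x - c‖ ≤ r := by
  have hle : x - T ≤ x + T := by linarith
  nth_rw 1 [← steklovAverage_const hT.ne' c x]
  rw [← steklovAverage_sub hf continuous_const, steklovAverage, norm_smul,
    Real.norm_of_nonneg (by positivity), one_div_mul_eq_div, div_le_iff₀' (by positivity)]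
  calc ‖∫ t in (x - T)..(x + T), f t - c‖ ≤ r * |x + T - (x - T)| :=
        intervalIntegral.norm_integral_le_of_norm_le_const fun t ht =>
          h t (Set.Ioc_subset_Icc_self (Set.uIoc_of_le hle ▸ ht))
    _ = 2 * T * r := by rw [abs_of_nonneg (by linarith)]; ring

lemma norm_steklovAverage_le (hf : Continuous f) (hT : 0 < T) (hM : ∀ t, ‖f t‖ ≤ M) (x : ℝ) :
    ‖steklovAverage T f x‖ ≤ M := by
  rw [← sub_zero (steklovAverage T f x)]
  exact norm_steklovAverage_sub_le hf hT fun t _ => (sub_zero (f t)).symm ▸ hM t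

lemma norm_steklovAverage_sub_steklovAverage_le (hf : Continuous f) (hg : Continuous g)
    (hT : 0 < T) (h : ∀ t, ‖f t - g t‖ ≤ r) (x : ℝ) :
    ‖steklovAverage T f x - steklovAverage T g x‖ ≤ r := by
  rw [← steklovAverage_sub hf hg]
  exact norm_steklovAverage_le (hf.sub hg) hT h x

lemma steklovAverage_eq_symmDiffQuotient (hf : Continuous f) (hF : ∀ x, HasDerivAt F (f x) x) :
    steklovAverage T f = symmDiffQuotient T F := by
  ext x
  rw [steklovAverage, intervalIntegral.integral_eq_sub_of_hasDerivAt (fun y _ => hF y)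
    (hf.intervalIntegrable _ _), symmDiffQuotient]

lemma exists_forall_hasDerivAt_of_continuous (hf : Continuous f) :
    ∃ F : ℝ → X, ∀ x, HasDerivAt F (f x) x :=
  ⟨fun x => ∫ t in (0 : ℝ)..x, f t, fun x => (hf.integral_hasStrictDerivAt 0 x).hasDerivAt⟩

lemma hasDerivAt_steklovAverage (hf : Continuous f) (x : ℝ) :
    HasDerivAt (steklovAverage T f) (symmDiffQuotient T f x) x := by
  obtain ⟨F, hF⟩ := exists_forall_hasDerivAt_of_continuous hf
  rw [steklovAverage_eq_symmDiffQuotient hf hF]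
  exact hasDerivAt_symmDiffQuotient hF x

lemma continuous_steklovAverage (hf : Continuous f) : Continuous (steklovAverage T f) :=
  continuous_iff_continuousAt.2 fun x => (hasDerivAt_steklovAverage hf x).continuousAt

lemma hasDerivAt_steklovAverage_of_hasDerivAt (hf : Continuous f)
    (hF : ∀ x, HasDerivAt F (f x) x) (x : ℝ) :
    HasDerivAt (steklovAverage T F) (steklovAverage T f x) x := by
  rw [steklovAverage_eq_symmDiffQuotient hf hF]
  exact hasDerivAt_steklovAverage (continuous_iff_continuousAt.2 fun x => (hF x).continuousAt) x

lemma steklovAverage_comm (hf : Continuous f) (S T : ℝ) :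
    steklovAverage S (steklovAverage T f) = steklovAverage T (steklovAverage S f) := by
  obtain ⟨F, hF⟩ := exists_forall_hasDerivAt_of_continuous hf
  obtain ⟨H, hH⟩ := exists_forall_hasDerivAt_of_continuous
    (continuous_iff_continuousAt.2 fun x => (hF x).continuousAt)
  have iterate (S T : ℝ) :
      steklovAverage S (steklovAverage T f) = symmDiffQuotient S (symmDiffQuotient T H) := by
    refine steklovAverage_eq_symmDiffQuotient (continuous_steklovAverage hf) fun x => ?_
    rw [steklovAverage_eq_symmDiffQuotient hf hF]
    exact hasDerivAt_symmDiffQuotient hH x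
  rw [iterate S T, iterate T S, symmDiffQuotient_comm]

lemma norm_steklovAverage_sub_steklovAverage_le_mul (hf : Continuous f) (hT : 0 < T)
    (hM : ∀ x, ‖f x‖ ≤ M) (x y : ℝ) :
    ‖steklovAverage T f x - steklovAverage T f y‖ ≤ M / T * ‖x - y‖ :=
  convex_univ.norm_image_sub_le_of_norm_hasDerivWithin_le
    (fun z _ => (hasDerivAt_steklovAverage hf z).hasDerivWithinAt)
    (fun z _ => norm_symmDiffQuotient_le hT hM z) (Set.mem_univ y) (Set.mem_univ x)

lemma exists_forall_norm_steklovAverage_sub_le (hf : UniformContinuous f) {ε : ℝ} (hε : 0 < ε) :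
    ∃ d : ℝ, 0 < d ∧ ∀ x, ‖steklovAverage d f x - f x‖ ≤ ε := by
  obtain ⟨δ, hδ, hfδ⟩ := Metric.uniformContinuous_iff.1 hf ε hε
  refine ⟨δ / 2, half_pos hδ, fun x =>
    norm_steklovAverage_sub_le hf.continuous (half_pos hδ) fun t ht => ?_⟩
  rw [← dist_eq_norm]
  exact (hfδ (abs_lt.2 ⟨by linarith [ht.1], by linarith [ht.2]⟩)).le

lemma norm_steklovAverage_sub_le_mul (hF : ∀ x, HasDerivAt F (f x) x) (hM : ∀ x, ‖f x‖ ≤ M)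
    (hT : 0 < T) (x : ℝ) : ‖steklovAverage T F x - F x‖ ≤ M * T := by
  have hM0 : 0 ≤ M := (norm_nonneg _).trans (hM 0)
  refine norm_steklovAverage_sub_le
    (continuous_iff_continuousAt.2 fun y => (hF y).continuousAt) hT fun t ht => ?_
  calc ‖F t - F x‖ ≤ M * ‖t - x‖ := convex_univ.norm_image_sub_le_of_norm_hasDerivWithin_le
        (fun z _ => (hF z).hasDerivWithinAt) (fun z _ => hM z) (Set.mem_univ x) (Set.mem_univ t)
    _ ≤ M * T := by
        gcongr
        exact abs_le.2 ⟨by linarith [ht.1], by linarith [ht.2]⟩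

end Steklov

section Mean

variable {X : Type*} [NormedAddCommGroup X] [NormedSpace ℝ X] [CompleteSpace X] {f : ℝ → X} {m : X}

namespace IsBohrAlmostPeriodic

lemma eventually_norm_steklovAverage_sub_le (hf : IsBohrAlmostPeriodic f) {ε : ℝ} (hε : 0 < ε) :
    ∀ᶠ T : ℝ in atTop, ∀ a b, ‖steklovAverage T f a - steklovAverage T f b‖ ≤ ε := by
  obtain ⟨M, hM0, hM⟩ := hf.totallyBounded_range.isBounded.exists_pos_norm_le
  obtain ⟨L, hL⟩ := hf.exists_forall_sub_mem_Icc (half_pos hε)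
  filter_upwards [eventually_gt_atTop 0, eventually_ge_atTop (2 * M * L / ε)] with T hT hTL a b
  obtain ⟨t, ⟨hbt, htL⟩, ht⟩ := hL a b
  have hshift : ‖steklovAverage T f a - steklovAverage T f (a - t)‖ ≤ ε / 2 := by
    rw [← steklovAverage_comp_sub_right]
    exact norm_steklovAverage_sub_steklovAverage_le hf.1
      (hf.1.comp (continuous_id.sub continuous_const)) hT (fun y => (ht y).le) a
  have hlip : ‖steklovAverage T f (a - t) - steklovAverage T f b‖ ≤ ε / 2 :=
    calc _ ≤ M / T * ‖a - t - b‖ := norm_steklovAverage_sub_steklovAverage_le_mul hf.1 hT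
          (fun y => hM _ (Set.mem_range_self y)) _ _
      _ ≤ M / T * L := by
          gcongr
          exact abs_le.2 ⟨by linarith, by linarith⟩
      _ ≤ ε / 2 := by
          rw [div_le_iff₀ hε] at hTL
          rw [div_mul_eq_mul_div, div_le_iff₀ hT]
          linarith
  calc ‖steklovAverage T f a - steklovAverage T f b‖ ≤ _ :=
        norm_sub_le_norm_sub_add_norm_sub _ (steklovAverage T f (a - t)) _
    _ ≤ ε := by linarith

/-- Both averages are compared with the iterated one, in which the order of `S` and `T` does not
matter. -/
lemma exists_forall_norm_steklovAverage_sub_le (hf : IsBohrAlmostPeriodic f) {ε : ℝ} (hε : 0 < ε) :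
    ∃ N : ℝ, ∀ S ≥ N, ∀ T ≥ N, ∀ a b, ‖steklovAverage S f a - steklovAverage T f b‖ ≤ ε := by
  obtain ⟨N, hN⟩ := eventually_atTop.1 ((eventually_gt_atTop (0 : ℝ)).and
    (hf.eventually_norm_steklovAverage_sub_le (half_pos hε)))
  have iterate {S T : ℝ} (hS : S ≥ N) (hT : T ≥ N) (a : ℝ) :
      ‖steklovAverage T (steklovAverage S f) 0 - steklovAverage S f a‖ ≤ ε / 2 :=
    norm_steklovAverage_sub_le (continuous_steklovAverage hf.1) (hN T hT).1
      fun t _ => (hN S hS).2 t a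
  refine ⟨N, fun S hS T hT a b => ?_⟩
  have hSa := iterate hS hT a
  rw [steklovAverage_comm hf.1, norm_sub_rev] at hSa
  calc ‖steklovAverage S f a - steklovAverage T f b‖ ≤ _ :=
        norm_sub_le_norm_sub_add_norm_sub _ (steklovAverage S (steklovAverage T f) 0) _
    _ ≤ ε := by linarith [iterate hT hS b]

theorem exists_hasMean (hf : IsBohrAlmostPeriodic f) : ∃ m : X, HasMean f m := by
  have hcauchy : CauchySeq fun T => steklovAverage T f 0 :=
    Metric.cauchySeq_iff.2 fun ε hε => by
      obtain ⟨N, hN⟩ := hf.exists_forall_norm_steklovAverage_sub_le (half_pos hε)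
      exact ⟨N, fun S hS T hT => (dist_eq_norm _ _).trans_lt
        ((hN S hS T hT 0 0).trans_lt (half_lt_self hε))⟩
  obtain ⟨m, hm⟩ := cauchySeq_tendsto_of_complete hcauchy
  refine ⟨m, hf.1.locallyIntegrable, Metric.tendstoUniformly_iff.2 fun ε hε => ?_⟩
  obtain ⟨N, hN⟩ := hf.exists_forall_norm_steklovAverage_sub_le (half_pos hε)
  filter_upwards [eventually_ge_atTop N] with T hT a
  refine lt_of_le_of_lt (le_of_tendsto (hm.dist tendsto_const_nhds) ?_) (half_lt_self hε)
  filter_upwards [eventually_ge_atTop N] with S hS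
  exact (dist_eq_norm _ _).trans_le (hN S hS T hT 0 a)

end IsBohrAlmostPeriodic

namespace HasMean

lemma clm_comp {Y : Type*} [NormedAddCommGroup Y] [NormedSpace ℝ Y] [CompleteSpace Y]
    (hm : HasMean f m) (φ : X →L[ℝ] Y) : HasMean (fun x => φ (f x)) (φ m) := by
  refine ⟨fun x => (hm.1 x).imp fun s hs => ⟨hs.1, φ.integrable_comp hs.2⟩, ?_⟩
  have hcomm (T a : ℝ) : ∫ x in (a - T)..(a + T), φ (f x) = φ (∫ x in (a - T)..(a + T), f x) :=
    φ.intervalIntegral_comp_comm (hm.1.integrableOn_isCompact isCompact_uIcc).intervalIntegrable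
  simp only [hcomm, ← map_smul]
  exact φ.uniformContinuous.comp_tendstoUniformly hm.2

lemma exists_norm_sub_sub_le (hm : HasMean f m) (hf : UniformContinuous f) {ε : ℝ} (hε : 0 < ε) :
    ∃ d T : ℝ, 0 < d ∧ 0 < T ∧ ∀ x, ‖f x - m -
      (steklovAverage d f x - steklovAverage T (steklovAverage d f) x)‖ ≤ ε := by
  have hε₃ : 0 < ε / 3 := by positivity
  obtain ⟨d, hd, hdf⟩ := exists_forall_norm_steklovAverage_sub_le hf hε₃
  obtain ⟨T, hT, hTm⟩ := ((eventually_gt_atTop (0 : ℝ)).and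
    (Metric.tendstoUniformly_iff.1 hm.2 (ε / 3) hε₃)).exists
  refine ⟨d, T, hd, hT, fun x => ?_⟩
  have hTd : ‖steklovAverage T (steklovAverage d f) x - steklovAverage T f x‖ ≤ ε / 3 :=
    norm_steklovAverage_sub_steklovAverage_le (continuous_steklovAverage hf.continuous)
      hf.continuous hT hdf x
  have hTx : ‖steklovAverage T f x - m‖ ≤ ε / 3 := by
    rw [← dist_eq_norm']
    exact (hTm x).le
  calc _ = ‖(steklovAverage T (steklovAverage d f) x - steklovAverage T f x) +
          (steklovAverage T f x - m) - (steklovAverage d f x - f x)‖ := by congr 1; abel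
    _ ≤ ε / 3 + ε / 3 + ε / 3 := norm_sub_le_of_le (norm_add_le_of_le hTd hTx) (hdf x)
    _ = ε := by ring

end HasMean

end Mean

section StrongLaw

variable {Ω : Type*} [MeasurableSpace Ω] {μ : Measure Ω}

lemma tendsto_average_of_tendsto_average_sq {u : ℕ → ℝ} {C : ℝ} (hu : ∀ n, |u n| ≤ C)
    (h : Tendsto (fun k : ℕ => (∑ n ∈ Finset.range (k ^ 2), u n) / (k ^ 2 : ℕ)) atTop (𝓝 0)) :
    Tendsto (fun N : ℕ => (∑ n ∈ Finset.range N, u n) / N) atTop (𝓝 0) := by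
  -- Adding `C` makes the partial sums monotone, so that convergence along the squares suffices.
  have hshift {N : ℕ} (hN : 0 < N) : (∑ n ∈ Finset.range N, (u n + C)) / (N : ℝ)
      = (∑ n ∈ Finset.range N, u n) / N + C := by
    rw [Finset.sum_add_distrib, Finset.sum_const, Finset.card_range, nsmul_eq_mul]
    field_simp
  have hmono : Monotone fun N => ∑ n ∈ Finset.range N, (u n + C) :=
    monotone_nat_of_le_succ fun N => by
      rw [Finset.sum_range_succ]
      linarith [(abs_le.1 (hu N)).1]
  have hratio {a : ℝ} (ha : 1 < a) :
      ∀ᶠ k : ℕ in atTop, (((k + 1) ^ 2 : ℕ) : ℝ) ≤ a * (k ^ 2 : ℕ) := by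
    filter_upwards [tendsto_natCast_atTop_atTop.eventually_ge_atTop (3 / (a - 1)),
      eventually_ge_atTop 1] with k hk hk₁
    have hk₁' : (1 : ℝ) ≤ k := by exact_mod_cast hk₁
    rw [div_le_iff₀ (by linarith)] at hk
    push_cast
    nlinarith
  have hsq : Tendsto (fun k : ℕ => (∑ n ∈ Finset.range (k ^ 2), (u n + C)) / (k ^ 2 : ℕ))
      atTop (𝓝 C) := by
    refine (zero_add C ▸ h.add_const C).congr' ?_
    filter_upwards [eventually_gt_atTop 0] with k hk
    rw [hshift (by positivity)]
  have hlim := tendsto_div_of_monotone_of_exists_subseq_tendsto_div _ C hmono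
    fun a ha => ⟨fun k => k ^ 2, hratio ha, tendsto_pow_atTop two_ne_zero, hsq⟩
  refine (sub_self C ▸ hlim.sub_const C).congr' ?_
  filter_upwards [eventually_gt_atTop 0] with N hN
  rw [hshift hN, add_sub_cancel_right]

lemma ae_tendsto_zero_of_summable_integral {v : ℕ → Ω → ℝ} (hv : ∀ k, Integrable (v k) μ)
    (hv₀ : ∀ k, 0 ≤ v k) (hsum : Summable fun k => ∫ ω, v k ω ∂μ) :
    ∀ᵐ ω ∂μ, Tendsto (fun k => v k ω) atTop (𝓝 0) := by
  have hmeas (k : ℕ) : AEMeasurable (fun ω => ENNReal.ofReal (v k ω)) μ :=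
    (hv k).1.aemeasurable.ennreal_ofReal
  have hfin : ∫⁻ ω, ∑' k, ENNReal.ofReal (v k ω) ∂μ ≠ ∞ := by
    rw [lintegral_tsum hmeas]
    simp only [← ofReal_integral_eq_lintegral_ofReal (hv _) (.of_forall (hv₀ _))]
    exact hsum.tsum_ofReal_ne_top
  filter_upwards [ae_lt_top' (AEMeasurable.tsum hmeas) hfin] with ω hω
  have hlim := (ENNReal.tendsto_toReal ENNReal.zero_ne_top).comp
    (ENNReal.tendsto_atTop_zero_of_tsum_ne_top hω.ne)
  exact hlim.congr fun k => ENNReal.toReal_ofReal (hv₀ k ω)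

theorem ae_tendsto_average_of_integral_sum_sq_le {u : ℕ → Ω → ℝ} {C D : ℝ}
    (hu : ∀ n, MemLp (u n) 2 μ) (hC : ∀ n, ∀ᵐ ω ∂μ, |u n ω| ≤ C)
    (hD : ∀ N : ℕ, ∫ ω, (∑ n ∈ Finset.range N, u n ω) ^ 2 ∂μ ≤ D * N) :
    ∀ᵐ ω ∂μ, Tendsto (fun N : ℕ => (∑ n ∈ Finset.range N, u n ω) / N) atTop (𝓝 0) := by
  let v (k : ℕ) (ω : Ω) : ℝ := ((∑ n ∈ Finset.range (k ^ 2), u n ω) / (k ^ 2 : ℕ)) ^ 2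
  have hv (k : ℕ) : Integrable (v k) μ := by
    simp only [v, div_pow]
    exact (memLp_finsetSum _ fun n _ => hu n).integrable_sq.div_const _
  have hvD (k : ℕ) : ∫ ω, v k ω ∂μ ≤ D * (1 / (k : ℝ) ^ 2) := by
    simp only [v, div_pow, integral_div]
    rcases Nat.eq_zero_or_pos k with rfl | hk
    · simp
    · rw [div_le_iff₀ (by positivity)]
      refine (hD (k ^ 2)).trans_eq ?_
      push_cast
      field_simp
  have hsum : Summable fun k => ∫ ω, v k ω ∂μ :=
    .of_nonneg_of_le (fun k => integral_nonneg fun ω => sq_nonneg _) hvD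
      ((Real.summable_one_div_nat_pow.2 one_lt_two).mul_left D)
  filter_upwards [ae_tendsto_zero_of_summable_integral hv (fun k ω => sq_nonneg _) hsum,
    ae_all_iff.2 hC] with ω hω hCω
  refine tendsto_average_of_tendsto_average_sq hCω ((tendsto_zero_iff_abs_tendsto_zero _).2 ?_)
  exact (Real.sqrt_zero ▸ hω.sqrt).congr fun k => Real.sqrt_sq_eq_abs _

lemma integral_sum_sq_le_of_integral_mul_le_geometric {u : ℕ → Ω → ℝ} {K ρ : ℝ}
    (hu : ∀ n, MemLp (u n) 2 μ) (hρ₀ : 0 ≤ ρ) (hρ₁ : ρ < 1)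
    (hcor : ∀ m n, n ≤ m → ∫ ω, u m ω * u n ω ∂μ ≤ K * ρ ^ (m - n)) (N : ℕ) :
    ∫ ω, (∑ n ∈ Finset.range N, u n ω) ^ 2 ∂μ ≤ 2 * K * (1 - ρ)⁻¹ * N := by
  have hK : 0 ≤ K := by
    simpa using (integral_nonneg fun ω => mul_self_nonneg (u 0 ω)).trans (hcor 0 0 le_rfl)
  induction N with
  | zero => simp
  | succ N ih =>
    have hsq : Integrable (fun ω => (∑ n ∈ Finset.range N, u n ω) ^ 2) μ :=
      (memLp_finsetSum _ fun n _ => hu n).integrable_sq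
    have hsq' : Integrable (fun ω => (∑ n ∈ Finset.range (N + 1), u n ω) ^ 2) μ :=
      (memLp_finsetSum _ fun n _ => hu n).integrable_sq
    have hmul (n : ℕ) : Integrable (fun ω => u N ω * u n ω) μ := (hu N).integrable_mul (hu n)
    have hmul' : Integrable (fun ω => 2 * ∑ n ∈ Finset.range (N + 1), u N ω * u n ω) μ :=
      (integrable_finsetSum _ fun n _ => hmul n).const_mul 2
    have hgeom : ∑ n ∈ Finset.range (N + 1), ρ ^ (N - n) ≤ (1 - ρ)⁻¹ := by
      have hreflect := Finset.sum_range_reflect (fun n => ρ ^ n) (N + 1)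
      simp only [Nat.add_sub_cancel] at hreflect
      rw [hreflect, ← tsum_geometric_of_lt_one hρ₀ hρ₁]
      exact (summable_geometric_of_lt_one hρ₀ hρ₁).sum_le_tsum _ fun _ _ => by positivity
    calc ∫ ω, (∑ n ∈ Finset.range (N + 1), u n ω) ^ 2 ∂μ
        ≤ ∫ ω, ((∑ n ∈ Finset.range N, u n ω) ^ 2 +
            2 * ∑ n ∈ Finset.range (N + 1), u N ω * u n ω) ∂μ := by
          refine integral_mono hsq' (hsq.add hmul') fun ω => ?_
          simp only [← Finset.mul_sum, Finset.sum_range_succ]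
          nlinarith [sq_nonneg (u N ω)]
      _ = ∫ ω, (∑ n ∈ Finset.range N, u n ω) ^ 2 ∂μ +
            2 * ∑ n ∈ Finset.range (N + 1), ∫ ω, u N ω * u n ω ∂μ := by
          rw [integral_add hsq hmul', integral_const_mul, integral_finsetSum _ fun n _ => hmul n]
      _ ≤ 2 * K * (1 - ρ)⁻¹ * N + 2 * ∑ n ∈ Finset.range (N + 1), K * ρ ^ (N - n) := by
          gcongr with n hn
          exact hcor N n (Nat.lt_succ_iff.1 (Finset.mem_range.1 hn))
      _ ≤ 2 * K * (1 - ρ)⁻¹ * N + 2 * (K * (1 - ρ)⁻¹) := by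
          rw [← Finset.mul_sum]
          gcongr
      _ = 2 * K * (1 - ρ)⁻¹ * (N + 1 : ℕ) := by push_cast; ring

end StrongLaw

section BoundedPrimitive

lemma abs_integral_deriv_mul_le {u u' v v' : ℝ → ℝ} {A B C a b : ℝ} (hab : a ≤ b)
    (hu : ∀ x, HasDerivAt u (u' x) x) (hv : ∀ x, HasDerivAt v (v' x) x) (hu' : Continuous u')
    (hv' : Continuous v') (hA : ∀ x, |u x| ≤ A) (hB : ∀ x, |v x| ≤ B) (hC : ∀ x, |v' x| ≤ C) :
    |∫ x in a..b, u' x * v x| ≤ A * (2 * B + C * (b - a)) := by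
  have hparts := intervalIntegral.integral_mul_deriv_eq_deriv_mul (fun x _ => hv x)
    (fun x _ => hu x) (hv'.intervalIntegrable a b) (hu'.intervalIntegrable a b)
  have hboundary (x : ℝ) : ‖v x * u x‖ ≤ B * A :=
    norm_mul_le_of_le (hB x) (hA x)
  have hintegral : ‖∫ x in a..b, v' x * u x‖ ≤ C * A * (b - a) := by
    rw [← abs_of_nonneg (sub_nonneg.2 hab)]
    exact intervalIntegral.norm_integral_le_of_norm_le_const fun x _ =>
      norm_mul_le_of_le (hC x) (hA x)
  simp only [mul_comm (u' _), hparts]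
  calc ‖v b * u b - v a * u a - ∫ x in a..b, v' x * u x‖ ≤ B * A + B * A + C * A * (b - a) :=
        norm_sub_le_of_le (norm_sub_le_of_le (hboundary b) (hboundary a)) hintegral
    _ = A * (2 * B + C * (b - a)) := by ring

lemma abs_integral_comp_mul_mul_comp_mul_le {P p h h' : ℝ → ℝ} {A B C a b β γ : ℝ} (hab : a ≤ b)
    (hP : ∀ x, HasDerivAt P (p x) x) (hh : ∀ x, HasDerivAt h (h' x) x) (hp : Continuous p)
    (hh' : Continuous h') (hA : ∀ x, |P x| ≤ A) (hB : ∀ x, |h x| ≤ B) (hC : ∀ x, |h' x| ≤ C)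
    (hβ : β ≠ 0) :
    |∫ x in a..b, p (β * x) * h (γ * x)| ≤ A / |β| * (2 * B + |γ| * C * (b - a)) := by
  refine abs_integral_deriv_mul_le (u := fun x => P (β * x) / β) (v' := fun x => γ * h' (γ * x))
    hab (fun x => ?_) (fun x => ?_) (by fun_prop) (by fun_prop) (fun x => ?_) (fun x => hB _)
    (fun x => ?_)
  · simpa [hβ] using! ((hP (β * x)).comp x ((hasDerivAt_id x).const_mul β)).div_const β
  · simpa [mul_comm] using! (hh (γ * x)).comp x ((hasDerivAt_id x).const_mul γ)
  · rw [abs_div]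
    exact div_le_div_of_nonneg_right (hA _) (abs_nonneg β)
  · rw [abs_mul]
    exact mul_le_mul_of_nonneg_left (hC _) (abs_nonneg γ)

variable {Q q r : ℝ → ℝ} {A B C α : ℝ}

lemma integral_comp_pow_mul_mul_comp_pow_mul_le {a b : ℝ} (hab : a ≤ b)
    (hQ : ∀ x, HasDerivAt Q (q x) x) (hq : ∀ x, HasDerivAt q (r x) x) (hr : Continuous r)
    (hA : ∀ x, |Q x| ≤ A) (hB : ∀ x, |q x| ≤ B) (hC : ∀ x, |r x| ≤ C) (hα : 1 ≤ |α|)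
    {m n : ℕ} (hnm : n ≤ m) :
    ∫ x in a..b, q (α ^ m * x) * q (α ^ n * x)
      ≤ A * (2 * B + C * (b - a)) * |α|⁻¹ ^ (m - n) := by
  have hα₀ : 0 < |α| := one_pos.trans_le hα
  have hA₀ : 0 ≤ A := (abs_nonneg _).trans (hA 0)
  have hB₀ : 0 ≤ B := (abs_nonneg _).trans (hB 0)
  have hqc : Continuous q := continuous_iff_continuousAt.2 fun x => (hq x).continuousAt
  calc _ ≤ A / |α ^ m| * (2 * B + |α ^ n| * C * (b - a)) :=
        (le_abs_self _).trans (abs_integral_comp_mul_mul_comp_mul_le hab hQ hq hqc hr hA hB hC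
          (pow_ne_zero m (abs_pos.1 hα₀)))
    _ ≤ A / |α ^ m| * (|α ^ n| * (2 * B) + |α ^ n| * C * (b - a)) := by
        gcongr ?_ * (?_ + _)
        exact le_mul_of_one_le_left (mul_nonneg zero_le_two hB₀) (abs_pow α n ▸ one_le_pow₀ hα)
    _ = A * (2 * B + C * (b - a)) * |α|⁻¹ ^ (m - n) := by
        rw [abs_pow, abs_pow, inv_pow, pow_sub₀ _ hα₀.ne' hnm]
        field_simp

theorem ae_tendsto_average_of_bounded_primitive (hQ : ∀ x, HasDerivAt Q (q x) x)
    (hq : ∀ x, HasDerivAt q (r x) x) (hr : Continuous r) (hA : ∀ x, |Q x| ≤ A)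
    (hB : ∀ x, |q x| ≤ B) (hC : ∀ x, |r x| ≤ C) (hα : 1 < |α|) :
    ∀ᵐ x : ℝ, Tendsto (fun N : ℕ => (1 / (N : ℝ)) • ∑ n ∈ Finset.range N, q (α ^ n * x))
      atTop (𝓝 0) := by
  have hqc : Continuous q := continuous_iff_continuousAt.2 fun x => (hq x).continuousAt
  have hlocal (k : ℕ) : ∀ᵐ x : ℝ, x ∈ Set.Ioc (-k : ℝ) k →
      Tendsto (fun N : ℕ => (∑ n ∈ Finset.range N, q (α ^ n * x)) / N) atTop (𝓝 0) := by
    have hk : (-k : ℝ) ≤ k := by simp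
    have hmem (n : ℕ) : MemLp (fun x => q (α ^ n * x)) 2 (volume.restrict (Set.Ioc (-k : ℝ) k)) :=
      .of_bound (by fun_prop) B (.of_forall fun x => hB _)
    have hcor (m n : ℕ) (hnm : n ≤ m) : ∫ x in Set.Ioc (-k : ℝ) k, q (α ^ m * x) * q (α ^ n * x)
        ≤ A * (2 * B + C * (k - -k)) * |α|⁻¹ ^ (m - n) := by
      rw [← intervalIntegral.integral_of_le hk]
      exact integral_comp_pow_mul_mul_comp_pow_mul_le hk hQ hq hr hA hB hC hα.le hnm
    have hsecond := integral_sum_sq_le_of_integral_mul_le_geometric hmem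
      (inv_nonneg.2 (abs_nonneg α)) (inv_lt_one_of_one_lt₀ hα) hcor
    exact (ae_restrict_iff' measurableSet_Ioc).1
      (ae_tendsto_average_of_integral_sum_sq_le hmem (fun n => .of_forall fun x => hB _) hsecond)
  filter_upwards [ae_all_iff.2 hlocal] with x hx
  obtain ⟨k, hk⟩ := exists_nat_gt |x|
  simpa only [smul_eq_mul, one_div_mul_eq_div] using hx k ⟨(abs_lt.1 hk).1, (abs_lt.1 hk).2.le⟩

theorem ae_tendsto_average_sub_steklovAverage {g g' : ℝ → ℝ} {T : ℝ}
    (hg : ∀ x, HasDerivAt g (g' x) x) (hg' : Continuous g') (hB : ∀ x, |g x| ≤ B)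
    (hC : ∀ x, |g' x| ≤ C) (hT : 0 < T) (hα : 1 < |α|) :
    ∀ᵐ x : ℝ, Tendsto (fun N : ℕ => (1 / (N : ℝ)) • ∑ n ∈ Finset.range N,
      (g (α ^ n * x) - steklovAverage T g (α ^ n * x))) atTop (𝓝 0) := by
  have hgc : Continuous g := continuous_iff_continuousAt.2 fun x => (hg x).continuousAt
  obtain ⟨G, hG⟩ := exists_forall_hasDerivAt_of_continuous hgc
  exact ae_tendsto_average_of_bounded_primitive (q := fun x => g x - steklovAverage T g x)
    (fun x => (hG x).sub (hasDerivAt_steklovAverage_of_hasDerivAt hgc hG x))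
    (fun x => (hg x).sub (hasDerivAt_steklovAverage_of_hasDerivAt hg' hg x))
    (hg'.sub (continuous_steklovAverage hg'))
    (fun x => (abs_sub_comm _ _).trans_le (norm_steklovAverage_sub_le_mul hG hB hT x))
    (fun x => norm_sub_le_of_le (hB x) (norm_steklovAverage_le hgc hT hB x))
    (fun x => norm_sub_le_of_le (hC x) (norm_steklovAverage_le hg' hT hC x)) hα

end BoundedPrimitive

section Pointwise

lemma tendsto_average_of_forall_exists_approx {E : Type*} [NormedAddCommGroup E] [NormedSpace ℝ E]
    {s : ℕ → E} {l : E} (h : ∀ ε : ℝ, 0 < ε → ∃ t : ℕ → E, (∀ n, ‖s n - l - t n‖ ≤ ε) ∧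
      Tendsto (fun N : ℕ => (1 / (N : ℝ)) • ∑ n ∈ Finset.range N, t n) atTop (𝓝 0)) :
    Tendsto (fun N : ℕ => (1 / (N : ℝ)) • ∑ n ∈ Finset.range N, s n) atTop (𝓝 l) := by
  refine Metric.tendsto_nhds.2 fun ε hε => ?_
  obtain ⟨t, hst, ht⟩ := h (ε / 2) (half_pos hε)
  filter_upwards [Metric.tendsto_nhds.1 ht (ε / 2) (half_pos hε), eventually_gt_atTop 0]
    with N htN hN
  have hN₀ : (0 : ℝ) < N := by exact_mod_cast hN
  have hdecomp : (1 / (N : ℝ)) • ∑ n ∈ Finset.range N, s n - l =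
      (1 / (N : ℝ)) • ∑ n ∈ Finset.range N, (s n - l - t n) +
        (1 / (N : ℝ)) • ∑ n ∈ Finset.range N, t n := by
    rw [← smul_add, ← Finset.sum_add_distrib]
    simp only [sub_add_cancel, Finset.sum_sub_distrib, Finset.sum_const, Finset.card_range,
      smul_sub, ← Nat.cast_smul_eq_nsmul ℝ, smul_smul, one_div_mul_cancel hN₀.ne', one_smul]
  have herr : ‖(1 / (N : ℝ)) • ∑ n ∈ Finset.range N, (s n - l - t n)‖ ≤ ε / 2 := by
    rw [norm_smul, Real.norm_of_nonneg (by positivity), one_div_mul_eq_div, div_le_iff₀' hN₀]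
    simpa using norm_sum_le_of_le (Finset.range N) fun n _ => hst n
  rw [dist_zero_right] at htN
  rw [dist_eq_norm, hdecomp]
  linarith [norm_add_le_of_le herr htN.le, norm_add_le ((1 / (N : ℝ)) •
    ∑ n ∈ Finset.range N, (s n - l - t n)) ((1 / (N : ℝ)) • ∑ n ∈ Finset.range N, t n)]

theorem HasMean.ae_tendsto_average_real {f : ℝ → ℝ} {m M α : ℝ} (hm : HasMean f m)
    (hf : UniformContinuous f) (hM : ∀ x, |f x| ≤ M) (hα : 1 < |α|) :
    ∀ᵐ x : ℝ, Tendsto (fun N : ℕ => (1 / (N : ℝ)) • ∑ n ∈ Finset.range N, f (α ^ n * x))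
      atTop (𝓝 m) := by
  choose d T hd hT happrox using fun k : ℕ =>
    hm.exists_norm_sub_sub_le hf (Nat.one_div_pos_of_nat (n := k))
  have hquot (k : ℕ) : Continuous (symmDiffQuotient (d k) f) := by
    have := hf.continuous
    unfold symmDiffQuotient
    fun_prop
  have hae (k : ℕ) := ae_tendsto_average_sub_steklovAverage
    (hasDerivAt_steklovAverage hf.continuous) (hquot k)
    (fun x => norm_steklovAverage_le hf.continuous (hd k) hM x)
    (fun x => norm_symmDiffQuotient_le (f := f) (hd k) hM x) (hT k) hα
  filter_upwards [ae_all_iff.2 hae] with x hx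
  refine tendsto_average_of_forall_exists_approx fun ε hε => ?_
  obtain ⟨k, hk⟩ := exists_nat_one_div_lt hε
  exact ⟨_, fun n => (happrox k (α ^ n * x)).trans hk.le, hx k⟩

end Pointwise

section WeakConvergence

lemma exists_countable_dual_separating_of_isSeparable (𝕜 : Type*) [RCLike 𝕜] {E : Type*}
    [NormedAddCommGroup E] [NormedSpace 𝕜 E] {s : Set E} (hs : TopologicalSpace.IsSeparable s) :
    ∃ D : Set (StrongDual 𝕜 E), D.Countable ∧ ∀ y ∈ s, (∀ φ ∈ D, φ y = 0) → y = 0 := by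
  obtain ⟨c, hc, hsc⟩ := hs
  choose φ hφ hφx using fun x : E => exists_dual_vector'' 𝕜 x
  refine ⟨φ '' c, hc.image φ, fun y hy hzero => norm_le_zero_iff.1 (le_of_forall_pos_le_add ?_)⟩
  intro ε hε
  obtain ⟨x, hx, hyx⟩ := Metric.mem_closure_iff.1 (hsc hy) (ε / 2) (half_pos hε)
  have hnorm : ‖x‖ ≤ ‖y - x‖ :=
    calc ‖x‖ = ‖φ x (y - x)‖ := by simp [hzero _ (Set.mem_image_of_mem φ hx), hφx]
      _ ≤ ‖y - x‖ := (φ x).le_of_opNorm_le_of_le (hφ x) le_rfl |>.trans_eq (one_mul _)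
  rw [dist_eq_norm] at hyx
  linarith [norm_le_norm_sub_add y x]

lemma tendsto_of_isCompact_of_forall_tendsto_comp {ι κ E F : Type*} [TopologicalSpace E]
    [TopologicalSpace F] [T2Space F] {K : Set E} (hK : IsCompact K) {φ : κ → E → F}
    (hφ : ∀ k, Continuous (φ k)) {l : Filter ι} {u : ι → E} {y : E} (hu : ∀ᶠ i in l, u i ∈ K)
    (hsep : ∀ z ∈ K, (∀ k, φ k z = φ k y) → z = y)
    (hlim : ∀ k, Tendsto (fun i => φ k (u i)) l (𝓝 (φ k y))) : Tendsto u l (𝓝 y) := by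
  refine hK.tendsto_nhds_of_unique_mapClusterPt hu fun z hz hcluster => hsep z hz fun k => ?_
  exact eq_of_nhds_neBot ((hcluster.continuousAt_comp (hφ k).continuousAt).clusterPt.mono (hlim k))

lemma one_div_smul_sum_range_mem_convexHull {E : Type*} [AddCommGroup E] [Module ℝ E] {s : Set E}
    {u : ℕ → E} (hu : ∀ n, u n ∈ s) {N : ℕ} (hN : N ≠ 0) :
    (1 / (N : ℝ)) • ∑ n ∈ Finset.range N, u n ∈ convexHull ℝ s := by
  rw [Finset.smul_sum]
  refine (convex_convexHull ℝ s).sum_mem (fun _ _ => by positivity) ?_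
    fun n _ => subset_convexHull ℝ s (hu n)
  simp [hN]

variable {X : Type*} [NormedAddCommGroup X] [NormedSpace ℝ X] [CompleteSpace X]

theorem HasMean.ae_tendsto_average {f : ℝ → X} {m : X} {α : ℝ} (hm : HasMean f m)
    (hf : UniformContinuous f) (hrange : TotallyBounded (Set.range f)) (hα : 1 < |α|) :
    ∀ᵐ x : ℝ, Tendsto (fun N : ℕ => (1 / (N : ℝ)) • ∑ n ∈ Finset.range N, f (α ^ n * x))
      atTop (𝓝 m) := by
  have hK : IsCompact (closure (convexHull ℝ (Set.range f))) :=
    isCompact_iff_totallyBounded_isComplete.2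
      ⟨hrange.convexHull.closure, isClosed_closure.isComplete⟩
  obtain ⟨D, hD, hsep⟩ := exists_countable_dual_separating_of_isSeparable ℝ
    (hK.image (continuous_sub_right m)).isSeparable
  have hscalar (φ : StrongDual ℝ X) : ∀ᵐ x : ℝ, Tendsto (fun N : ℕ => (1 / (N : ℝ)) •
      ∑ n ∈ Finset.range N, φ (f (α ^ n * x))) atTop (𝓝 (φ m)) := by
    obtain ⟨M, hM⟩ := (φ.lipschitz.isBounded_image hrange.isBounded).exists_norm_le
    exact (hm.clm_comp φ).ae_tendsto_average_real (φ.uniformContinuous.comp hf)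
      (fun x => hM _ ⟨f x, ⟨x, rfl⟩, rfl⟩) hα
  filter_upwards [(ae_ball_iff hD).2 fun φ _ => hscalar φ] with x hx
  refine tendsto_of_isCompact_of_forall_tendsto_comp hK (fun φ : D => φ.1.continuous) ?_ ?_
    fun φ => by simpa only [map_smul, map_sum] using hx φ φ.2
  · filter_upwards [eventually_ne_atTop 0] with N hN
    exact subset_closure
      (one_div_smul_sum_range_mem_convexHull (fun n => Set.mem_range_self _) hN)
  · intro z hz hzm
    refine sub_eq_zero.1 (hsep _ ⟨z, hz, rfl⟩ fun φ hφ => ?_)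
    rw [map_sub, hzm ⟨φ, hφ⟩, sub_self]

end WeakConvergence

theorem mainTheorem4 {X : Type*} [NormedAddCommGroup X] [NormedSpace ℝ X] [CompleteSpace X]
    (f : ℝ → X) (hf : IsBohrAlmostPeriodic f) :
    ∃ m : X, HasMean f m ∧
      ∀ α : ℝ, 1 < |α| →
        ∀ᵐ x : ℝ ∂volume,
          Tendsto (fun N : ℕ => (1 / (N : ℝ)) • ∑ n ∈ Finset.range N, f (α ^ n * x))
            atTop (𝓝 m) := by
  obtain ⟨m, hm⟩ := hf.exists_hasMean
  exact ⟨m, hm, fun α hα => hm.ae_tendsto_average hf.uniformContinuous hf.totallyBounded_range hα⟩
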